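/- Let $K,L,N_0$ be integers with $K>L\ge 3$, $N_0\ge 3$ and $\frac L4<N_0<\frac K2$. Let $\Lambda=(V,E)$ be the two-dimensional periodic square lattice with vertex set $V=\mathbb{T}_K\times\mathbb{T}_L$, where $\mathbb{T}_M=\mathbb{Z}/M\mathbb{Z}$, and with $E$ the set of unordered nearest-neighbour bonds. Let $$\Omega=\Big\{\eta\in\{0,1\}^V:\ \sum_{x\in V}\eta(x)=LN_0\Big\},\qquad \mathbb{H}(\eta)=-\sum_{\{x,y\}\in E}\eta(x)\eta(y)\quad(\eta\in\Omega).$$ For $\eta,\xi\in\Omega$ write $\eta\sim\xi$ if $\xi\neq\eta$ and $\xi$ is obtained from $\eta$ by exchanging the values at $x$ and $y$ for some bond $\{x,y\}\in E$ (a jump of the Kawasaki dynamics). A path from $\eta$ to $\xi$ is a finite sequence $\omega=(\omega_n)_{n=0}^N$ in $\Omega$ with $\omega_0=\eta$, $\omega_N=\xi$ and $\omega_n\sim\omega_{n+1}$ for $0\le n<N$. The communication height between $\eta$ and $\xi$ is $$\Phi(\eta,\xi)=\min_{\omega:\,\eta\to\xi}\ \max_{0\le n\le N}\mathbb{H}(\omega_n).$$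 For $k\in\mathbb{T}_K$ let $\sigma^k\in\Omega$ be the configuration whose occupied sites are exactly those of the $N_0$ consecutive columns $\{k,k+1,\dots,k+N_0-1\}\times\mathbb{T}_L$, and let $\mathbb{H}_0=-2LN_0+L$. Then for all distinct $k,k'\in\mathbb{T}_K$ there is a path from $\sigma^k$ to $\sigma^{k'}$, and $$\Phi(\sigma^k,\sigma^{k'})=\mathbb{H}_0+4.$$ -/

import Mathlib

namespace Kawasaki

section General

/-! Energy landscapes: a graph `G` on a state space `Ω`, with an integer valued energy `H`. -/

variable {Ω : Type*} {G : SimpleGraph Ω}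

/-- The height of a path `ω = (ω₀, …, ω_N)`: the maximum of `H (ω_n)` over `0 ≤ n ≤ N`. -/
def pathHeight (H : Ω → ℤ) {η ξ : Ω} (ω : G.Walk η ξ) : ℤ :=
  (Finset.range (ω.length + 1)).sup' ⟨0, by simp⟩ (fun n => H (ω.getVert n))

/-- The communication height (energy barrier) between `η` and `ξ`: the minimal height of a path
from `η` to `ξ`. By `isLeast_commHeight` the infimum is attained as soon as there is a path. -/
noncomputable def commHeight (G : SimpleGraph Ω) (H : Ω → ℤ) (η ξ : Ω) : ℤ :=
  sInf (Set.range fun ω : G.Walk η ξ => pathHeight H ω)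

theorem isLeast_commHeight {H : Ω → ℤ} {η ξ : Ω} (h : G.Reachable η ξ) :
    IsLeast (Set.range fun ω : G.Walk η ξ => pathHeight H ω) (commHeight G H η ξ) := by
  have hne : (Set.range fun ω : G.Walk η ξ => pathHeight H ω).Nonempty := by
    obtain ⟨ω⟩ := h
    exact ⟨_, ω, rfl⟩
  have hbd : BddBelow (Set.range fun ω : G.Walk η ξ => pathHeight H ω) := by
    refine ⟨H η, ?_⟩
    rintro _ ⟨ω, rfl⟩
    have h0 := Finset.le_sup' (fun n => H (ω.getVert n))
      (show 0 ∈ Finset.range (ω.length + 1) by simp)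
    simpa [pathHeight] using h0
  exact ⟨Int.csInf_mem hne hbd, fun _ hx => csInf_le hbd hx⟩

end General

section Model

/-- The vertex set `V = 𝕋_K × 𝕋_L` of the periodic lattice. -/
abbrev Site (K L : ℕ) : Type := ZMod K × ZMod L

/-- The periodic square lattice: `x` and `y` are neighbours if they agree in one coordinate and
differ by exactly `1` in the other one. -/
def lattice (K L : ℕ) : SimpleGraph (Site K L) :=
  (SimpleGraph.circulantGraph ({1} : Set (ZMod K))).boxProd
    (SimpleGraph.circulantGraph ({1} : Set (ZMod L)))

theorem lattice_adj {K L : ℕ} {x y : Site K L} :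
    (lattice K L).Adj x y ↔ x ≠ y ∧
      ((x.2 = y.2 ∧ (x.1 - y.1 = 1 ∨ y.1 - x.1 = 1)) ∨
        (x.1 = y.1 ∧ (x.2 - y.2 = 1 ∨ y.2 - x.2 = 1))) := by
  obtain ⟨a, b⟩ := x
  obtain ⟨c, d⟩ := y
  simp only [lattice, SimpleGraph.boxProd_adj, SimpleGraph.circulantGraph_adj,
    Set.mem_singleton_iff, ne_eq, Prod.mk.injEq]
  tauto

instance (K L : ℕ) : DecidableRel (lattice K L).Adj :=
  fun _ _ => decidable_of_iff' _ lattice_adj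

/-- Particle configurations `η ∈ {0,1}^V` with exactly `N` particles. -/
def Config (K L N : ℕ) [NeZero K] [NeZero L] : Type :=
  {η : Site K L → Fin 2 // ∑ x, (η x : ℕ) = N}

/-- The Hamiltonian `H(η) = -∑_{{x,y} ∈ E} η(x) η(y)`. -/
def energy {K L N : ℕ} [NeZero K] [NeZero L] (η : Config K L N) : ℤ :=
  -∑ e ∈ (lattice K L).edgeFinset, (e.map fun x => ((η.1 x : ℕ) : ℤ)).mul

/-- The graph of Kawasaki dynamics: `η ∼ ξ` if `ξ ≠ η` is obtained from `η` by exchanging the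
states at the two ends of a bond of the lattice. -/
def kawasakiGraph (K L N : ℕ) [NeZero K] [NeZero L] : SimpleGraph (Config K L N) where
  Adj η ξ := η ≠ ξ ∧ ∃ x y, (lattice K L).Adj x y ∧ ξ.1 = η.1 ∘ Equiv.swap x y
  symm := ⟨by
    rintro η ξ ⟨hne, x, y, hxy, h⟩
    refine ⟨hne.symm, x, y, hxy, ?_⟩
    rw [h]
    funext z
    simp⟩
  loopless := ⟨fun _ h => h.1 rfl⟩

/-- The configuration `σ^k`, occupied exactly on the columns `k, k + 1, …, k + N₀ - 1`. -/
def groundState (K L N₀ : ℕ) [NeZero K] [NeZero L] (hN : N₀ ≤ K) (k : ZMod K) :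
    Config K L (L * N₀) :=
  ⟨fun x => if ∃ i < N₀, x.1 = k + (i : ZMod K) then 1 else 0, by
    classical
    have hinj : Set.InjOn (fun i : ℕ => k + (i : ZMod K)) (Finset.range N₀) := by
      intro i hi j hj hij
      simp only [Finset.coe_range, Set.mem_Iio] at hi hj
      have h := congrArg ZMod.val (add_left_cancel hij)
      rwa [ZMod.val_natCast_of_lt (by omega), ZMod.val_natCast_of_lt (by omega)] at h
    have hcard : (Finset.univ.filter fun a : ZMod K => ∃ i < N₀, a = k + (i : ZMod K)).card
        = N₀ := by
      have : (Finset.univ.filter fun a : ZMod K => ∃ i < N₀, a = k + (i : ZMod K))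
          = (Finset.range N₀).image (fun i : ℕ => k + (i : ZMod K)) := by
        ext a
        simp [eq_comm]
      rw [this, Finset.card_image_of_injOn hinj, Finset.card_range]
    have hval : ∀ p : Prop, ∀ _ : Decidable p,
        (((if p then 1 else 0 : Fin 2) : Fin 2) : ℕ) = if p then 1 else 0 := by
      intro p _
      split_ifs <;> rfl
    simp only [hval, Fintype.sum_prod_type]
    trans ∑ a : ZMod K, L * (if ∃ i < N₀, a = k + (i : ZMod K) then 1 else 0)
    · refine Finset.sum_congr rfl fun a _ => ?_
      by_cases h : ∃ i < N₀, a = k + (i : ZMod K)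
      · simp only [if_pos h, Finset.sum_const, Finset.card_univ, ZMod.card, smul_eq_mul]
      · simp only [if_neg h, Finset.sum_const_zero, mul_zero]
    · rw [← Finset.mul_sum, Finset.sum_boole, hcard, Nat.cast_id]⟩

end Model

end Kawasaki

/-! The energy is minus the number of bonds between occupied sites. Let `B` be that number for a
stripe. A path that stays strictly below the claimed height only visits configurations with at least
`B - 3` bonds.

Lower bound: such a path cannot escape a small trap around the initial stripe. One particle may
leave the stripe and wander, and the vacancy may wander too. A second particle leaving brings the
count to at most `B - 3`, with equality only if it leaves next to the first vacancy and lands next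
to the first particle (`jump_oneOff_outward`). In this tight configuration no jump may lose a bond,
so essentially the only way on is for one of the two particles to return (`jump_twoOff`); for `L =
3` the pair can also be reflected. Hence at most two particles are ever outside, forming a vertical
pair if there are two, whereas another stripe fills a whole column outside the first
(`not_trapped`).

Upper bound: to shift a stripe by one column, carry the particles of its left column, row by row,
leftwards around the torus to the right side. Without the travelling particle, the background has `B
- 3` bonds in the first row and at least `B - 4` afterwards (`le_bonds_partialStripe`); the
traveller can only add bonds. Iterating the shift connects any two stripes. -/

namespace Kawasaki

/-! ### Counting bonds and their change under a move. -/

/-- The occupation numbers of a configuration, as integers. -/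
def occ {K L N : ℕ} [NeZero K] [NeZero L] (η : Config K L N) : Site K L → ℤ :=
  fun x => ((η.1 x : ℕ) : ℤ)

/-- The number of bonds between occupied sites. -/
def bonds {K L : ℕ} [NeZero K] [NeZero L] (f : Site K L → ℤ) : ℤ :=
  ∑ x : Site K L, f x * (f (x.1 + 1, x.2) + f (x.1, x.2 + 1))

/-- The number of occupied neighbours of a site. -/
def nbr {K L : ℕ} (f : Site K L → ℤ) (x : Site K L) : ℤ :=
  f (x.1 + 1, x.2) + f (x.1 - 1, x.2) + f (x.1, x.2 + 1) + f (x.1, x.2 - 1)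

theorem natCast_ne_zero {M n : ℕ} (hn : 0 < n) (hM : n < M) : (n : ZMod M) ≠ 0 := by
  rw [Ne, ZMod.natCast_eq_zero_iff]
  exact fun h => absurd (Nat.le_of_dvd hn h) (by omega)

theorem one_ne_zero_zmod {M : ℕ} (hM : 3 ≤ M) : (1 : ZMod M) ≠ 0 := by
  simpa using natCast_ne_zero (M := M) (n := 1) (by omega) (by omega)

theorem two_ne_zero_zmod {M : ℕ} (hM : 3 ≤ M) : (2 : ZMod M) ≠ 0 := by
  simpa using natCast_ne_zero (M := M) (n := 2) (by omega) (by omega)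

variable {K L : ℕ} [NeZero K] [NeZero L]

/-- Orienting every bond in the positive direction lists it exactly once. This needs `2 ≠ 0` in both
coordinates: on a cycle of length two, both endpoints would give the same bond. -/
theorem sum_edgeFinset (hK : 3 ≤ K) (hL : 3 ≤ L) (F : Sym2 (Site K L) → ℤ) :
    ∑ e ∈ (lattice K L).edgeFinset, F e
      = ∑ x : Site K L, (F s(x, (x.1 + 1, x.2)) + F s(x, (x.1, x.2 + 1))) := by
  classical
  have k1 := one_ne_zero_zmod hK
  have k2 := two_ne_zero_zmod hK
  have l1 := one_ne_zero_zmod hL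
  have l2 := two_ne_zero_zmod hL
  have hh : Function.Injective fun x : Site K L => s(x, (x.1 + 1, x.2)) := by
    rintro ⟨a, b⟩ ⟨c, d⟩ h
    simp only [Sym2.eq_iff, Prod.mk.injEq] at h
    rcases h with h | ⟨⟨h1, -⟩, h2, -⟩
    · exact Prod.ext h.1.1 h.1.2
    · exact absurd (by linear_combination h2 - h1) k2
  have hv : Function.Injective fun x : Site K L => s(x, (x.1, x.2 + 1)) := by
    rintro ⟨a, b⟩ ⟨c, d⟩ h
    simp only [Sym2.eq_iff, Prod.mk.injEq] at h
    rcases h with h | ⟨⟨-, h1⟩, -, h2⟩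
    · exact Prod.ext h.1.1 h.1.2
    · exact absurd (by linear_combination h2 - h1) l2
  have hd : Disjoint (Finset.univ.image fun x : Site K L => s(x, (x.1 + 1, x.2)))
      (Finset.univ.image fun x : Site K L => s(x, (x.1, x.2 + 1))) := by
    rw [Finset.disjoint_left]
    simp only [Finset.mem_image, Finset.mem_univ, true_and]
    rintro _ ⟨⟨a, b⟩, rfl⟩ ⟨⟨c, d⟩, h⟩
    simp only [Sym2.eq_iff, Prod.mk.injEq] at h
    rcases h with ⟨⟨h1, -⟩, h2, -⟩ | ⟨⟨h1, -⟩, h2, -⟩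
    · exact k1 (by linear_combination h1 - h2)
    · exact k1 (by linear_combination h2 - h1)
  have hE : (lattice K L).edgeFinset
      = (Finset.univ.image fun x : Site K L => s(x, (x.1 + 1, x.2))) ∪
        (Finset.univ.image fun x : Site K L => s(x, (x.1, x.2 + 1))) := by
    ext e
    induction e using Sym2.ind with
    | h x y =>
      obtain ⟨a, b⟩ := x
      obtain ⟨c, d⟩ := y
      simp only [SimpleGraph.mem_edgeFinset, SimpleGraph.mem_edgeSet, lattice_adj,
        Finset.mem_union, Finset.mem_image, Finset.mem_univ, true_and, Prod.exists,
        Sym2.eq_iff, Prod.mk.injEq, ne_eq]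
      constructor
      · rintro ⟨-, ⟨rfl, h | h⟩ | ⟨rfl, h | h⟩⟩
        · exact .inl ⟨c, b, .inr (by simp [← h])⟩
        · exact .inl ⟨a, b, .inl (by simp [← h])⟩
        · exact .inr ⟨a, d, .inr (by simp [← h])⟩
        · exact .inr ⟨a, b, .inl (by simp [← h])⟩
      · rintro (⟨u, v, ⟨⟨rfl, rfl⟩, rfl, rfl⟩ | ⟨⟨rfl, rfl⟩, rfl, rfl⟩⟩ |
          ⟨u, v, ⟨⟨rfl, rfl⟩, rfl, rfl⟩ | ⟨⟨rfl, rfl⟩, rfl, rfl⟩⟩) <;> simp [k1, l1]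
  rw [hE, Finset.sum_union hd, Finset.sum_image fun _ _ _ _ h => hh h,
    Finset.sum_image fun _ _ _ _ h => hv h, Finset.sum_add_distrib]

theorem energy_eq (hK : 3 ≤ K) (hL : 3 ≤ L) {N : ℕ} (η : Config K L N) :
    energy η = -bonds (occ η) := by
  rw [energy, sum_edgeFinset hK hL, bonds]
  simp [occ, Sym2.map_mk, Sym2.mul_mk, mul_add]

/-- `bonds` is a quadratic form: the cross terms give `nbr`, and the diagonal term vanishes because
no site is its own neighbour. No restriction to values 0 and 1 is needed. -/
theorem bonds_add_single (hK : 3 ≤ K) (hL : 3 ≤ L) (f : Site K L → ℤ) (p : Site K L) :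
    bonds (f + Pi.single p 1) = bonds f + nbr f p := by
  have k1 := one_ne_zero_zmod hK
  have l1 := one_ne_zero_zmod hL
  obtain ⟨a, b⟩ := p
  have e1 : ∀ x : Site K L, ((x.1 + 1, x.2) = (a, b)) ↔ x = (a - 1, b) := by
    rintro ⟨u, v⟩
    simp [eq_sub_iff_add_eq]
  have e2 : ∀ x : Site K L, ((x.1, x.2 + 1) = (a, b)) ↔ x = (a, b - 1) := by
    rintro ⟨u, v⟩
    simp [eq_sub_iff_add_eq]
  simp only [bonds, nbr, Pi.add_apply, Pi.single_apply, e1, e2, add_mul, mul_add,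
    Finset.sum_add_distrib, ite_mul, mul_ite, one_mul, zero_mul, mul_one, mul_zero,
    Finset.sum_ite_eq', Finset.mem_univ, if_true, Prod.mk.injEq]
  simp [k1, l1, sub_eq_self]
  ring

omit [NeZero K] [NeZero L] in
theorem nbr_sub_single_self (hK : 3 ≤ K) (hL : 3 ≤ L) (f : Site K L → ℤ) (p : Site K L) :
    nbr (f - Pi.single p 1) p = nbr f p := by
  have k1 := one_ne_zero_zmod hK
  have l1 := one_ne_zero_zmod hL
  obtain ⟨a, b⟩ := p
  simp [nbr, k1, l1, sub_eq_self]

theorem bonds_sub_single (hK : 3 ≤ K) (hL : 3 ≤ L) (f : Site K L → ℤ) (p : Site K L) :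
    bonds (f - Pi.single p 1) = bonds f - nbr f p := by
  have h := bonds_add_single hK hL (f - Pi.single p 1) p
  rw [sub_add_cancel, nbr_sub_single_self hK hL] at h
  omega

/-- The change of the number of bonds when a particle moves from `p` to `q`. -/
theorem bonds_move (hK : 3 ≤ K) (hL : 3 ≤ L) (f : Site K L → ℤ) (p q : Site K L) :
    bonds (f - Pi.single p 1 + Pi.single q 1)
      = bonds f - nbr f p + nbr (f - Pi.single p 1) q := by
  rw [bonds_add_single hK hL, bonds_sub_single hK hL]

/-! ### Stripes, their excitations, and single jumps. -/

/-- The occupation numbers of the configuration with occupied columns `C`. -/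
noncomputable def stripe (K L : ℕ) (C : Set (ZMod K)) : Site K L → ℤ :=
  open Classical in fun x => if x.1 ∈ C then 1 else 0

omit [NeZero K] [NeZero L] in
theorem stripe_of_mem {C : Set (ZMod K)} {a : ZMod K} (h : a ∈ C) (b : ZMod L) :
    stripe K L C (a, b) = 1 := if_pos h

omit [NeZero K] [NeZero L] in
theorem stripe_of_notMem {C : Set (ZMod K)} {a : ZMod K} (h : a ∉ C) (b : ZMod L) :
    stripe K L C (a, b) = 0 := if_neg h

/-- Every boundary column of `C` is adjacent to at least two more columns of `C` on one side, and
to at least three columns of the complement on the other side. -/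
def ThickStripe (C : Set (ZMod K)) : Prop :=
  ∀ a t, (t = 1 ∨ t = -1) → a ∈ C → a + t ∉ C →
    a - t ∈ C ∧ a - t - t ∈ C ∧ a + t + t ∉ C ∧ a + t + t + t ∉ C

/-- One particle has left the stripe. -/
def OneOff (C : Set (ZMod K)) (f : Site K L → ℤ) : Prop :=
  ∃ x y : Site K L, x.1 ∈ C ∧ y.1 ∉ C ∧
    f = stripe K L C - Pi.single x 1 + Pi.single y 1

/-- Two particles have left the same boundary column of the stripe, and form a vertical pair in
the adjacent empty column, only one of the two being attached to the stripe. -/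
def TwoOff (C : Set (ZMod K)) (f : Site K L → ℤ) : Prop :=
  ∃ (c t : ZMod K) (m s : ZMod L), (t = 1 ∨ t = -1) ∧ (s = 1 ∨ s = -1) ∧ c ∈ C ∧ c + t ∉ C ∧
    f = stripe K L C - Pi.single (c, m - s) 1 - Pi.single (c, m) 1
      + Pi.single (c + t, m) 1 + Pi.single (c + t, m + s) 1

-- With signs `t` and `s` as parameters, left and right boundaries, and upward and downward moves,
-- are treated by one computation.
omit [NeZero K] [NeZero L] in
theorem nbr_eq {t : ZMod K} {s : ZMod L} (ht : t = 1 ∨ t = -1) (hs : s = 1 ∨ s = -1)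
    (f : Site K L → ℤ) (a : ZMod K) (b : ZMod L) :
    nbr f (a, b) = f (a + t, b) + f (a - t, b) + f (a, b + s) + f (a, b - s) := by
  rcases ht with rfl | rfl <;> rcases hs with rfl | rfl <;>
    simp only [nbr, sub_neg_eq_add, ← sub_eq_add_neg] <;> ring

omit [NeZero K] in
theorem unit_ne_zero (hK : 3 ≤ K) {t : ZMod K} (ht : t = 1 ∨ t = -1) : t ≠ 0 := by
  have := one_ne_zero_zmod hK
  rcases ht with rfl | rfl <;> simpa

omit [NeZero K] in
theorem unit_add_self_ne_zero (hK : 3 ≤ K) {t : ZMod K} (ht : t = 1 ∨ t = -1) : t + t ≠ 0 := by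
  have := two_ne_zero_zmod hK
  rcases ht with rfl | rfl
  · rwa [one_add_one_eq_two]
  · intro h
    exact this (by linear_combination -h)

/-- The bond joining the old site to the new one contributes neither before nor after the jump, so
only the three other neighbours of each site count. -/
theorem bonds_move_horizontal (hK : 3 ≤ K) (hL : 3 ≤ L) {t : ZMod K} {s : ZMod L}
    (ht : t = 1 ∨ t = -1) (hs : s = 1 ∨ s = -1) {f : Site K L → ℤ} {a : ZMod K} {b : ZMod L}
    (h1 : f (a, b) = 1) (h0 : f (a + t, b) = 0) :
    bonds (f - Pi.single (a, b) 1 + Pi.single (a + t, b) 1) = bonds f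
      - (f (a - t, b) + f (a, b + s) + f (a, b - s))
      + (f (a + t + t, b) + f (a + t, b + s) + f (a + t, b - s)) := by
  have t0 := unit_ne_zero hK ht
  have t2 := unit_add_self_ne_zero hK ht
  rw [bonds_move hK hL, nbr_eq ht hs, nbr_eq ht hs]
  simp [t0, t2, h0, h1, add_assoc]

theorem bonds_move_vertical (hK : 3 ≤ K) (hL : 3 ≤ L) {t : ZMod K} {s : ZMod L}
    (ht : t = 1 ∨ t = -1) (hs : s = 1 ∨ s = -1) {f : Site K L → ℤ} {a : ZMod K} {b : ZMod L}
    (h1 : f (a, b) = 1) (h0 : f (a, b + s) = 0) :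
    bonds (f - Pi.single (a, b) 1 + Pi.single (a, b + s) 1) = bonds f
      - (f (a + t, b) + f (a - t, b) + f (a, b - s))
      + (f (a + t, b + s) + f (a - t, b + s) + f (a, b + s + s)) := by
  have s0 := unit_ne_zero hL hs
  have s2 := unit_add_self_ne_zero hL hs
  rw [bonds_move hK hL, nbr_eq ht hs, nbr_eq ht hs]
  simp [s0, s2, h0, h1, add_assoc]

/-- `g` arises from `f` by a jump of a particle to an empty neighbouring site. -/
def Jump (f g : Site K L → ℤ) : Prop :=
  ∃ p q : Site K L, f p = 1 ∧ f q = 0 ∧ g = f - Pi.single p 1 + Pi.single q 1 ∧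
    ((∃ t : ZMod K, (t = 1 ∨ t = -1) ∧ q = (p.1 + t, p.2)) ∨
      ∃ s : ZMod L, (s = 1 ∨ s = -1) ∧ q = (p.1, p.2 + s))

omit [NeZero K] [NeZero L] in
theorem oneOff_of_jump_stripe {C : Set (ZMod K)} {g : Site K L → ℤ}
    (h : Jump (stripe K L C) g) : OneOff C g := by
  obtain ⟨p, q, hp, hq, rfl, -⟩ := h
  refine ⟨p, q, ?_, ?_, rfl⟩
  · by_contra hn
    simp [stripe, hn] at hp
  · intro hn
    simp [stripe, hn] at hq

theorem ite_cases (P : Prop) [Decidable P] :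
    (P ∧ (if P then (1 : ℤ) else 0) = 1) ∨ (¬P ∧ (if P then (1 : ℤ) else 0) = 0) := by
  by_cases h : P <;> simp [h]

theorem sum_ite_le_one {α : Type*} [DecidableEq α] (x : α) {a b d : α} (hab : a ≠ b)
    (had : a ≠ d) (hbd : b ≠ d) :
    (if x = a then (1 : ℤ) else 0) + (if x = b then 1 else 0) + (if x = d then 1 else 0) ≤ 1 := by
  split_ifs <;> simp_all

/-! ### The trap around a thick stripe. -/

section Thick
variable {C : Set (ZMod K)} (hC : ThickStripe C)
include hC

omit [NeZero K] [NeZero L] in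
theorem three_le_nbr_stripe (x : Site K L) (hx : x.1 ∈ C) : 3 ≤ nbr (stripe K L C) x := by
  obtain ⟨a, b⟩ := x
  have h1 := hC a 1 (.inl rfl) hx
  have h2 := hC a (-1) (.inr rfl) hx
  simp only [sub_neg_eq_add, ← sub_eq_add_neg] at h1 h2
  by_cases ha : a + 1 ∈ C <;> by_cases hb : a - 1 ∈ C <;> simp_all [nbr, stripe]

omit [NeZero K] [NeZero L] in
theorem nbr_stripe_le_one (x : Site K L) (hx : x.1 ∉ C) : nbr (stripe K L C) x ≤ 1 := by
  obtain ⟨a, b⟩ := x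
  have h1 := hC (a + 1) (-1) (.inr rfl)
  have h2 := hC (a - 1) 1 (.inl rfl)
  simp only [sub_neg_eq_add, ← sub_eq_add_neg, sub_add_cancel, add_sub_cancel_right] at h1 h2
  by_cases ha : a + 1 ∈ C <;> by_cases hb : a - 1 ∈ C <;> simp_all [nbr, stripe]

/-- Removing `x` costs at least 3 bonds and placing `y` gains at most 1. The second particle loses
3, or 2 if it borders the vacancy `x`, and gains at most 1, only if it lands beside `y`. The total
is at most `-3 + 1 - 2 + 1 = -3`, so the lower bound on `bonds g` makes every estimate tight. -/
theorem jump_oneOff_outward (hK : 3 ≤ K) (hL : 3 ≤ L) {x y : Site K L} (hx : x.1 ∈ C)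
    (hy : y.1 ∉ C) {c t : ZMod K} {m : ZMod L} (ht : t = 1 ∨ t = -1)
    (hc : c ∈ C) (hct : c + t ∉ C) {f g : Site K L → ℤ}
    (hf : f = stripe K L C - Pi.single x 1 + Pi.single y 1)
    (hp : f (c, m) = 1) (hq : f (c + t, m) = 0)
    (hg : g = f - Pi.single (c, m) 1 + Pi.single (c + t, m) 1)
    (hB : bonds (stripe K L C) - 3 ≤ bonds g) :
    TwoOff C g ∧ bonds g ≤ bonds (stripe K L C) - 3 := by
  obtain ⟨ci, cii, co, coo⟩ := hC c t ht hc hct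
  have t0 := unit_ne_zero hK ht
  have hbf : bonds f = bonds (stripe K L C) - nbr (stripe K L C) x
      + nbr (stripe K L C - Pi.single x 1) y := by rw [hf, bonds_move hK hL]
  have hx3 := three_le_nbr_stripe hC x hx
  have hxi : ∀ b, x = (c - t, b) → nbr (stripe K L C) x = 4 := by
    rintro b rfl
    rw [nbr_eq ht (.inl rfl)]
    simp [stripe, ci, cii, hc]
  have hle : ∀ z : Site K L, (stripe K L C - Pi.single x 1 : Site K L → ℤ) z ≤ stripe K L C z := by
    intro z
    simp only [Pi.sub_apply, Pi.single_apply]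
    split_ifs <;> omega
  have hy1 : nbr (stripe K L C - Pi.single x 1) y ≤ 1 := by
    refine le_trans ?_ (nbr_stripe_le_one hC y hy)
    unfold nbr
    gcongr <;> exact hle _
  have hyo : ∀ b, y = (c + t + t, b) → nbr (stripe K L C - Pi.single x 1) y ≤ 0 := by
    rintro b rfl
    have h0 : nbr (stripe K L C) (c + t + t, b) = 0 := by
      rw [nbr_eq ht (.inl rfl)]
      simp [stripe, hct, co, coo]
    rw [← h0]
    unfold nbr
    gcongr <;> exact hle _
  have hxy : ∀ b, x = (c, b) → y = (c + t, b) →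
      nbr (stripe K L C - Pi.single x 1) y ≤ 0 := by
    rintro b rfl rfl
    rw [nbr_eq ht (.inl rfl)]
    have hne : c + t + t ≠ c := fun h => co (by rwa [h])
    simp [stripe, hct, co, hc, t0, hne]
  have hbg := bonds_move_horizontal hK hL ht (s := 1) (.inl rfl) hp hq
  rw [← hg] at hbg
  have e : ∀ a ∈ C, ∀ b, f (a, b) = 1 - if x = (a, b) then 1 else 0 := by
    intro a ha b
    have : y ≠ (a, b) := by rintro rfl; exact hy ha
    simp [hf, stripe, ha, Pi.single_apply, this.symm, eq_comm]
  have e' : ∀ a ∉ C, ∀ b, f (a, b) = if y = (a, b) then 1 else 0 := by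
    intro a ha b
    have : x ≠ (a, b) := by rintro rfl; exact ha hx
    simp [hf, stripe, ha, Pi.single_apply, this.symm, eq_comm]
  rw [e _ ci, e _ hc, e _ hc, e' _ co, e' _ hct, e' _ hct] at hbg
  have hm : m + 1 ≠ m - 1 := fun h => two_ne_zero_zmod hL (by linear_combination h)
  have hxs := sum_ite_le_one x (a := (c - t, m)) (b := (c, m + 1)) (d := (c, m - 1))
    (by simp [t0]) (by simp [t0]) (by simp [hm])
  have hys := sum_ite_le_one y (a := (c + t + t, m)) (b := (c + t, m + 1)) (d := (c + t, m - 1))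
    (by simp [t0]) (by simp [t0]) (by simp [hm])
  refine ⟨?_, by omega⟩
  have hxi' := hxi m
  have hyo' := hyo m
  -- Tightness excludes a vacancy in the inner column (loss 4) and `y` in the farther outer column
  -- (gain 0). It also excludes `x` and `y` in the same row, where `y` would face the vacancy; hence
  -- they lie on opposite sides of row `m`.
  have hd : ∃ s : ZMod L, (s = 1 ∨ s = -1) ∧ x = (c, m - s) ∧ y = (c + t, m + s) := by
    have hp1 := hxy (m + 1)
    have hn1 := hxy (m - 1)
    rcases ite_cases (x = (c - t, m)) with ⟨h1, i1⟩ | ⟨h1, i1⟩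
    · have := hxi' h1
      omega
    rcases ite_cases (y = (c + t + t, m)) with ⟨h2, i2⟩ | ⟨h2, i2⟩
    · have := hyo' h2
      omega
    rcases ite_cases (x = (c, m + 1)) with ⟨h3, i3⟩ | ⟨h3, i3⟩
    · rcases ite_cases (y = (c + t, m + 1)) with ⟨h4, i4⟩ | ⟨h4, i4⟩
      · have := hp1 h3 h4
        omega
      · rcases ite_cases (y = (c + t, m - 1)) with ⟨h5, i5⟩ | ⟨h5, i5⟩
        · exact ⟨-1, .inr rfl, by simpa using h3, by simpa [← sub_eq_add_neg] using h5⟩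
        · omega
    · rcases ite_cases (x = (c, m - 1)) with ⟨h6, i6⟩ | ⟨h6, i6⟩
      · rcases ite_cases (y = (c + t, m - 1)) with ⟨h4, i4⟩ | ⟨h4, i4⟩
        · have := hn1 h6 h4
          omega
        · rcases ite_cases (y = (c + t, m + 1)) with ⟨h5, i5⟩ | ⟨h5, i5⟩
          · exact ⟨1, .inl rfl, h6, h5⟩
          · omega
      · omega
  obtain ⟨s, hs, rfl, rfl⟩ := hd
  refine ⟨c, t, m, s, ht, hs, hc, hct, ?_⟩
  rw [hg, hf]
  abel

end Thick
section Thick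
variable {C : Set (ZMod K)} (hC : ThickStripe C)
include hC

/-- A jump inside `C` moves the vacancy, a jump outside moves the free particle, and a jump into `C`
fills the vacancy. Only a jump out of `C` needs the energy bound. -/
theorem jump_oneOff (hK : 3 ≤ K) (hL : 3 ≤ L) {f g : Site K L → ℤ} (hf : OneOff C f)
    (h : Jump f g) (hB : bonds (stripe K L C) - 3 ≤ bonds g) :
    g = stripe K L C ∨ OneOff C g ∨ (TwoOff C g ∧ bonds g ≤ bonds (stripe K L C) - 3) := by
  obtain ⟨x, y, hx, hy, hf⟩ := hf
  obtain ⟨p, q, hp, hq, hg, hpq⟩ := h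
  have hin : ∀ z : Site K L, z.1 ∈ C → f z = 1 - if z = x then 1 else 0 := by
    intro z hz
    have : z ≠ y := by rintro rfl; exact hy hz
    simp [hf, stripe, hz, Pi.single_apply, this]
  have hout : ∀ z : Site K L, z.1 ∉ C → f z = if z = y then 1 else 0 := by
    intro z hz
    have : z ≠ x := by rintro rfl; exact hz hx
    simp [hf, stripe, hz, Pi.single_apply, this]
  by_cases hpC : p.1 ∈ C
  · by_cases hqC : q.1 ∈ C
    · have hqx : q = x := by
        by_contra hne
        simp [hin q hqC, hne] at hq
      refine .inr (.inl ⟨p, y, hpC, hy, ?_⟩)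
      rw [hg, hf, hqx]
      abel
    · rcases hpq with ⟨t, ht, hqt⟩ | ⟨s, -, hqs⟩
      · obtain ⟨c, m⟩ := p
        subst hqt
        exact .inr (.inr (jump_oneOff_outward hC hK hL hx hy ht hpC hqC hf hp hq hg hB))
      · rw [hqs] at hqC
        exact absurd hpC hqC
  · have hpy : p = y := by
      by_contra hne
      simp [hout p hpC, hne] at hp
    subst hpy
    by_cases hqC : q.1 ∈ C
    · have hqx : q = x := by
        by_contra hne
        simp [hin q hqC, hne] at hq
      left
      rw [hg, hf, hqx]
      abel
    · refine .inr (.inl ⟨x, q, hx, hqC, ?_⟩)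
      rw [hg, hf]
      abel

/-- The bounds on `f` and `g` together say that the jump loses no bond. Every jump other than a
return to the stripe loses at least one, except for reflections of the configuration when `L = 3`,
which are again of type `TwoOff`. -/
theorem jump_twoOff (hK : 3 ≤ K) (hL : 3 ≤ L) {f g : Site K L → ℤ} (hf : TwoOff C f)
    (hfB : bonds f ≤ bonds (stripe K L C) - 3)
    (h : Jump f g) (hB : bonds (stripe K L C) - 3 ≤ bonds g) :
    OneOff C g ∨ (TwoOff C g ∧ bonds g ≤ bonds (stripe K L C) - 3) := by
  obtain ⟨c, t, m, s, ht, hs, hc, hct, hf⟩ := hf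
  obtain ⟨p, q, hp, hq, hg, hpq⟩ := h
  obtain ⟨ci, cii, co, coo⟩ := hC c t ht hc hct
  have t0 := unit_ne_zero hK ht
  have t2 := unit_add_self_ne_zero hK ht
  have s0 := unit_ne_zero hL hs
  have s2 := unit_add_self_ne_zero hL hs
  have hms : m - s ≠ m := fun h => s0 (by linear_combination -h)
  have hms2 : m - s ≠ m + s := fun h => s2 (by linear_combination -h)
  have hms3 : m ≠ m + s := fun h => s0 (by linear_combination -h)
  have hneg : ∀ {M : ℕ} {t : ZMod M}, (t = 1 ∨ t = -1) → (-t = 1 ∨ -t = -1) := by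
    rintro M t (rfl | rfl) <;> simp
  have hopp : ∀ {M : ℕ} {t u : ZMod M}, (t = 1 ∨ t = -1) → (u = 1 ∨ u = -1) →
      u = t ∨ u = -t := by
    rintro M t u (rfl | rfl) (rfl | rfl) <;> simp
  -- values of the occupation numbers
  have hin : ∀ a ∈ C, ∀ b, f (a, b) = 1 - if a = c ∧ (b = m - s ∨ b = m) then 1 else 0 := by
    intro a ha b
    have : a ≠ c + t := by rintro rfl; exact hct ha
    simp only [hf, Pi.add_apply, Pi.sub_apply, stripe_of_mem ha, Pi.single_apply, Prod.mk.injEq,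
      this, false_and, if_false]
    by_cases h2 : b = m - s
    · subst h2
      simp [hms]
    · simp [h2]
  have hout : ∀ a ∉ C, ∀ b, f (a, b) = if a = c + t ∧ (b = m ∨ b = m + s) then 1 else 0 := by
    intro a ha b
    have : a ≠ c := by rintro rfl; exact ha hc
    simp only [hf, Pi.add_apply, Pi.sub_apply, stripe_of_notMem ha, Pi.single_apply,
      Prod.mk.injEq, this, false_and, if_false]
    by_cases h2 : b = m + s
    · subst h2
      simp [hms3.symm]
    · simp [h2]
  have hin' : ∀ a ∈ C, a ≠ c → ∀ b, f (a, b) = 1 := by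
    intro a ha hac b
    simp [hin a ha, hac]
  have hout' : ∀ a ∉ C, a ≠ c + t → ∀ b, f (a, b) = 0 := by
    intro a ha hac b
    simp [hout a ha, hac]
  have hle : ∀ z, f z ≤ 1 := by
    rintro ⟨a, b⟩
    by_cases ha : a ∈ C
    · rw [hin a ha]; split_ifs <;> simp
    · rw [hout a ha]; split_ifs <;> simp
  have hge : ∀ z, 0 ≤ f z := by
    rintro ⟨a, b⟩
    by_cases ha : a ∈ C
    · rw [hin a ha]; split_ifs <;> simp
    · rw [hout a ha]; split_ifs <;> simp
  have cne1 : c - t ≠ c := by simpa using t0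
  have cne2 : c - t - t ≠ c := fun h => t2 (by linear_combination -h)
  have cne3 : c + t + t ≠ c + t := by simpa using t0
  have cne4 : c + t + t + t ≠ c + t := fun h => t2 (by linear_combination h)
  obtain ⟨a, b⟩ := p
  by_cases haC : a ∈ C
  · by_cases hqC : q.1 ∈ C
    · -- a particle of the stripe moves into one of the two holes
      obtain ⟨u, v⟩ := q
      have huv : u = c ∧ (v = m - s ∨ v = m) := by
        by_contra hne
        simp [hin u hqC, hne] at hq
      obtain ⟨rfl, hv⟩ := huv
      have hab : ¬ (a = u ∧ (b = m - s ∨ b = m)) := by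
        intro hne
        rw [hin a haC, if_pos hne] at hp
        simp at hp
      rcases hpq with ⟨t', ht', hqt⟩ | ⟨s', hs', hqs⟩
      · simp only [Prod.mk.injEq] at hqt
        obtain ⟨h1, rfl⟩ := hqt
        have : t' = t := by
          rcases hopp ht ht' with h | h
          · exact h
          · exfalso
            subst h
            exact hct (by rw [h1]; simpa using haC)
        subst this
        obtain rfl : a = u - t' := by rw [h1]; ring
        have key := bonds_move_horizontal hK hL ht' hs hp (by simpa using hq)
        simp only [sub_add_cancel] at key
        rw [← hg, hin' _ cii cne2, hin' _ ci cne1, hin' _ ci cne1] at key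
        rcases hv with rfl | rfl
        · have e1 : f (u + t', m - s) = 0 := by simp [hout _ hct, hms, hms2]
          have e2 : f (u, m - s + s) = 0 := by simp [hin _ hc]
          have := hle (u, m - s - s)
          omega
        · have e1 : f (u, v - s) = 0 := by simp [hin _ hc]
          have := hle (u, v + s)
          have := hle (u + t', v)
          omega
      · simp only [Prod.mk.injEq] at hqs
        obtain ⟨rfl, hv'⟩ := hqs
        have key := bonds_move_vertical hK hL ht hs' hp (by rw [← hv']; exact hq)
        rw [← hv', ← hg, hin' _ ci cne1, hin' _ ci cne1] at key
        rcases hv with rfl | rfl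
        · have e1 : f (u + t, m - s) = 0 := by simp [hout _ hct, hms, hms2]
          rcases hopp hs hs' with rfl | rfl
          · obtain rfl : b = m - s' - s' := by rw [hv']; ring
            have e2 : f (u, m - s' + s') = 0 := by simp [hin _ hc]
            -- Equality means `L = 3`: the moving particle then faces one of the outside pair, and
            -- loses that bond instead of a vertical one.
            by_cases h3 : m - s' - s' = m + s'
            · have e3 : f (u + t, m - s' - s') = 1 := by simp [hout _ hct, h3]
              have := hge (u, m - s' - s' - s')
              omega
            · have e3 : f (u, m - s' - s' - s') = 1 := by
                have n1 : m - s' - s' - s' ≠ m := fun h => h3 (by linear_combination h)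
                have n2 : m - s' - s' - s' ≠ m - s' := fun h => s2 (by linear_combination -h)
                simp [hin _ hc, n1, n2]
              have := hge (u + t, m - s' - s')
              omega
          · exact absurd ⟨rfl, .inr (by linear_combination -hv')⟩ hab
        · rcases hopp hs hs' with rfl | rfl
          · exact absurd ⟨rfl, .inl (by rw [hv']; ring)⟩ hab
          · obtain rfl : b = v + s := by rw [hv']; ring
            have e1 : f (u + t, v) = 1 := by simp [hout _ hct]
            have e2 : f (u + t, v + s) = 1 := by simp [hout _ hct]
            have e3 : f (u, v + -s) = 0 := by simp [hin _ hc, ← sub_eq_add_neg]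
            rw [sub_neg_eq_add] at key
            -- Otherwise the moving particle loses the vertical bond to `v + s + s`. Equality forces
            -- `L = 3`, and the new configuration is of type `TwoOff` with `s` reversed.
            have h3 : v + s + s = v - s := by
              by_contra h3
              have n1 : v + s + s ≠ v := fun h => s2 (by linear_combination h)
              have : f (u, v + s + s) = 1 := by simp [hin _ hc, n1, h3]
              omega
            have := hge (u, v + s + s)
            refine .inr ⟨⟨u, t, v + s, -s, ht, hneg hs, hc, hct, ?_⟩, by omega⟩
            rw [hg, hf, sub_neg_eq_add, h3]
            simp only [add_neg_cancel_right]
            abel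
    · -- a third particle leaves the stripe
      rcases hpq with ⟨t', ht', hqt⟩ | ⟨s', -, rfl⟩
      · subst hqt
        obtain ⟨ai, aii, ao, aoo⟩ := hC a t' ht' haC hqC
        have key := bonds_move_horizontal hK hL ht' hs hp hq
        -- Thickness separates the two sides: here at least three occupied columns, and in the next
        -- claim at least three empty ones, keep the third particle away from the vacancies and the
        -- pair if it leaves elsewhere.
        have h1 : a - t' ≠ c := by
          rintro rfl
          rcases hopp ht' ht with rfl | rfl
          · exact hct (by simpa using haC)
          · exact hct (by simpa [← sub_eq_add_neg] using aii)
        have h2 : a + t' + t' ≠ c + t := by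
          intro h2
          rcases hopp ht' ht with rfl | rfl
          · exact hqC (by rw [add_right_cancel h2]; exact hc)
          · exact aoo (by rw [h2]; simpa using hc)
        rw [← hg, hin' _ ai h1, hout' _ ao h2] at key
        by_cases hac : a = c
        · subst hac
          obtain rfl : t' = t := by
            rcases hopp ht ht' with h | rfl
            · exact h
            · exact absurd (by simpa [← sub_eq_add_neg] using ci) hqC
          have b1 : ¬ (b = m - s ∨ b = m) := by
            intro hne
            simp [hin a haC, hne] at hp
          have b2 : ¬ (b = m ∨ b = m + s) := by
            intro hne
            simp [hout _ hqC, hne] at hq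
          push Not at b1 b2
          have e1 : f (a, b - s) = 1 := by
            have : b - s ≠ m := fun h => b2.2 (by rw [← h]; ring)
            simp [hin _ haC, this, b1.2]
          have e2 : f (a + t', b + s) = 0 := by
            have : b + s ≠ m := fun h => b1.1 (by rw [← h]; ring)
            simp [hout _ hqC, this, b1.2]
          have := hge (a, b + s)
          have := hle (a + t', b - s)
          omega
        · rw [hin' _ haC hac, hin' _ haC hac] at key
          have := hle (a + t', b + s)
          have := hle (a + t', b - s)
          omega
      · exact absurd haC hqC
  · have hab : a = c + t ∧ (b = m ∨ b = m + s) := by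
      by_contra hne
      simp [hout a haC, hne] at hp
    obtain ⟨rfl, hb⟩ := hab
    by_cases hqC : q.1 ∈ C
    · -- a particle returns to the stripe
      left
      obtain ⟨u, v⟩ := q
      have huv : u = c ∧ (v = m - s ∨ v = m) := by
        by_contra hne
        simp [hin u hqC, hne] at hq
      obtain ⟨rfl, hv⟩ := huv
      rcases hb with rfl | rfl <;> rcases hv with rfl | rfl
      · exact ⟨(u, b), (u + t, b + s), hc, hct, by rw [hg, hf]; abel⟩
      · exact ⟨(u, v - s), (u + t, v + s), hc, hct, by rw [hg, hf]; abel⟩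
      · exact ⟨(u, m), (u + t, m), hc, hct, by rw [hg, hf]; abel⟩
      · exact ⟨(u, v - s), (u + t, v), hc, hct, by rw [hg, hf]; abel⟩
    · -- a particle moves outside of the stripe
      rcases hpq with ⟨t', ht', rfl⟩ | ⟨s', hs', rfl⟩
      · obtain rfl : t' = t := by
          rcases hopp ht ht' with h | rfl
          · exact h
          · exact absurd (by simpa using hc) hqC
        have key := bonds_move_horizontal hK hL ht' hs hp hq
        rw [← hg, hout' _ coo cne4, hout' _ co cne3, hout' _ co cne3] at key
        rw [add_sub_cancel_right] at key
        have := hge (c, b)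
        have := hge (c + t', b + s)
        have := hge (c + t', b - s)
        rcases hb with rfl | rfl
        · have : f (c + t', b + s) = 1 := by simp [hout _ hct]
          omega
        · have : f (c + t', m + s - s) = 1 := by simp [hout _ hct]
          omega
      · have key := bonds_move_vertical hK hL ht hs' hp hq
        rw [← hg, hout' _ co cne3, hout' _ co cne3, add_sub_cancel_right] at key
        rcases hb with rfl | rfl
        · rcases hopp hs hs' with rfl | rfl
          · simp [hout _ hct] at hq
          · simp only [sub_neg_eq_add, ← sub_eq_add_neg] at key hg
            have e1 : f (c, b - s) = 0 := by simp [hin _ hc]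
            have e2 : f (c + t, b + s) = 1 := by simp [hout _ hct]
            have e3 := hge (c, b)
            -- Otherwise the pair breaks up and a bond is lost; for `L = 3` the particle meets its
            -- partner again on the other side.
            have h3 : b - s - s = b + s := by
              by_contra h3
              have n1 : b - s - s ≠ b := fun h => s2 (by linear_combination -h)
              have : f (c + t, b - s - s) = 0 := by simp [hout _ hct, n1, h3]
              omega
            have := hle (c + t, b - s - s)
            refine .inr ⟨⟨c, t, b - s, -s, ht, hneg hs, hc, hct, ?_⟩, by omega⟩
            rw [hg, hf, sub_neg_eq_add, ← sub_eq_add_neg, h3, sub_add_cancel]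
            abel
        · rcases hopp hs hs' with rfl | rfl
          · have e1 : f (c, m + s') = 1 := by simp [hin _ hc, hms2.symm, s0]
            have e2 : f (c + t, m + s' - s') = 1 := by simp [hout _ hct]
            have h1 := hle (c, m + s' + s')
            -- The jump loses the attachment to the stripe and the pair bond, so a gain of at most 1
            -- is a net loss. Both terms equal 1 only if `L = 3`, but then the first is the vacancy
            -- `m - s'`.
            have : f (c, m + s' + s') + f (c + t, m + s' + s' + s') ≤ 1 := by
              by_cases h3 : m + s' + s' + s' = m
              · have h4 : m + s' + s' = m - s' := by linear_combination h3
                have : f (c, m + s' + s') = 0 := by simp [hin _ hc, h4]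
                have := hle (c + t, m + s' + s' + s')
                omega
              · have n1 : m + s' + s' + s' ≠ m + s' := fun h => s2 (by linear_combination h)
                have : f (c + t, m + s' + s' + s') = 0 := by simp [hout _ hct, n1, h3]
                omega
            omega
          · simp [hout _ hct] at hq

/-- The configurations that are accessible from the stripe at a height of at most three. -/
def Trapped (C : Set (ZMod K)) (f : Site K L → ℤ) : Prop :=
  f = stripe K L C ∨ OneOff C f ∨ (TwoOff C f ∧ bonds f ≤ bonds (stripe K L C) - 3)

theorem trapped_of_jump (hK : 3 ≤ K) (hL : 3 ≤ L) {f g : Site K L → ℤ} (hf : Trapped C f)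
    (h : Jump f g) (hB : bonds (stripe K L C) - 3 ≤ bonds g) : Trapped C g := by
  rcases hf with rfl | hf | ⟨hf, hfB⟩
  · exact .inr (.inl (oneOff_of_jump_stripe h))
  · exact jump_oneOff hC hK hL hf h hB
  · exact .inr (jump_twoOff hC hK hL hf hfB h hB)

-- At most two particles are outside `C`, in rows that leave a site of column `a` empty as `3 ≤ L`.
omit hC in
theorem not_trapped (hL : 3 ≤ L) {f : Site K L → ℤ} {a : ZMod K} (ha : a ∉ C)
    (hf : ∀ b, f (a, b) = 1) : ¬ Trapped C f := by
  have l1 := one_ne_zero_zmod hL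
  rintro (rfl | ⟨x, y, hx, hy, rfl⟩ | ⟨⟨c, t, m, s, ht, hs, hc, hct, rfl⟩, -⟩)
  · simpa [stripe_of_notMem ha] using hf 0
  · have := hf (y.2 + 1)
    have h1 : (a, y.2 + 1) ≠ x := by rintro rfl; exact ha hx
    have h2 : (a, y.2 + 1) ≠ y := by
      intro h
      have := congrArg Prod.snd h
      simp [l1] at this
    simp [stripe_of_notMem ha, h1, h2] at this
  · have := hf (m - s)
    have h1 : a ≠ c := by rintro rfl; exact ha hc
    have hms : m - s ≠ m := fun h => unit_ne_zero hL hs (by linear_combination -h)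
    have hms2 : m - s ≠ m + s := fun h =>
      unit_add_self_ne_zero hL hs (by linear_combination -h)
    simp [stripe_of_notMem ha, h1, hms, hms2] at this

end Thick
-- Blocks of consecutive columns.
/-- The `n` consecutive columns `k, k + 1, …, k + n - 1`. -/
def cols (k : ZMod K) (n : ℕ) : Set (ZMod K) := {a | ∃ i < n, a = k + (i : ZMod K)}

theorem exists_eq_add (k a : ZMod K) : ∃ i < K, a = k + (i : ZMod K) :=
  ⟨(a - k).val, ZMod.val_lt _, by simp⟩

omit [NeZero K] in
theorem add_mem_cols {k : ZMod K} {n i : ℕ} (hn : n ≤ K) (hi : i < K) :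
    k + (i : ZMod K) ∈ cols k n ↔ i < n := by
  refine ⟨?_, fun h => ⟨i, h, rfl⟩⟩
  rintro ⟨j, hj, h⟩
  have h := congrArg ZMod.val (add_left_cancel h)
  rw [ZMod.val_natCast_of_lt hi, ZMod.val_natCast_of_lt (by omega)] at h
  omega

omit [NeZero K] in
theorem cols_succ (k : ZMod K) (n : ℕ) : cols k (n + 1) = insert k (cols (k + 1) n) := by
  ext a
  constructor
  · rintro ⟨i, hi, rfl⟩
    rcases i with _ | i
    · left; simp
    · right; exact ⟨i, by omega, by push_cast; ring⟩
  · rintro (rfl | ⟨i, hi, rfl⟩)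
    · exact ⟨0, by omega, by simp⟩
    · exact ⟨i + 1, by omega, by push_cast; ring⟩

omit [NeZero K] in
theorem cols_succ' (k : ZMod K) (n : ℕ) :
    cols k (n + 1) = insert (k + (n : ZMod K)) (cols k n) := by
  ext a
  constructor
  · rintro ⟨i, hi, rfl⟩
    rcases Nat.lt_succ_iff_lt_or_eq.mp hi with h | rfl
    · exact .inr ⟨i, h, rfl⟩
    · exact .inl rfl
  · rintro (rfl | ⟨i, hi, rfl⟩)
    · exact ⟨n, by omega, rfl⟩
    · exact ⟨i, by omega, rfl⟩

omit [NeZero K] in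
theorem thickStripe_cols {k : ZMod K} {n : ℕ} (h3 : 3 ≤ n) (hn : n + 3 ≤ K) :
    ThickStripe (cols k n) := by
  have hK : (K : ZMod K) = 0 := ZMod.natCast_self K
  have key : ∀ (i : ℕ) {a : ZMod K}, i < K → a = k + (i : ZMod K) → (a ∈ cols k n ↔ i < n) := by
    rintro i a hi rfl
    exact add_mem_cols (by omega) hi
  rintro a t (rfl | rfl) ⟨i, hi, rfl⟩ h
  · rw [key (i + 1) (by omega) (by push_cast; ring)] at h
    obtain ⟨j, rfl⟩ : ∃ j, i = j + 2 := ⟨i - 2, by omega⟩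
    refine ⟨?_, ?_, ?_, ?_⟩
    · rw [key (j + 1) (by omega) (by push_cast; ring)]; omega
    · rw [key j (by omega) (by push_cast; ring)]; omega
    · rw [key (j + 4) (by omega) (by push_cast; ring)]; omega
    · rw [key (j + 5) (by omega) (by push_cast; ring)]; omega
  · obtain rfl : i = 0 := by
      by_contra h0
      obtain ⟨j, rfl⟩ : ∃ j, i = j + 1 := ⟨i - 1, by omega⟩
      rw [key j (by omega) (by push_cast; ring)] at h
      omega
    refine ⟨?_, ?_, ?_, ?_⟩
    · rw [key 1 (by omega) (by push_cast; ring)]; omega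
    · rw [key 2 (by omega) (by push_cast; ring)]; omega
    · rw [key (K - 2) (by omega) (by push_cast [show 2 ≤ K by omega]; rw [hK]; ring)]; omega
    · rw [key (K - 3) (by omega) (by push_cast [show 3 ≤ K by omega]; rw [hK]; ring)]; omega

/-- Each row contributes `n` vertical bonds, counted from their lower ends, and `n - 1` horizontal
ones; since `n < K`, the last column has no right neighbour. -/
theorem bonds_stripe_cols {k : ZMod K} {n : ℕ} (h1 : 0 < n) (hn : n < K) :
    bonds (stripe K L (cols k n)) = L * (2 * n - 1) := by
  classical
  have hsum : ∀ F : ZMod K → ℤ,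
      ∑ a, (if a ∈ cols k n then F a else 0) = ∑ i ∈ Finset.range n, F (k + (i : ZMod K)) := by
    intro F
    rw [← Finset.sum_filter]
    have : (Finset.univ.filter fun a => a ∈ cols k n)
        = (Finset.range n).image (fun i : ℕ => k + (i : ZMod K)) := by
      ext a
      refine Finset.mem_filter.trans (Iff.trans ?_ Finset.mem_image.symm)
      constructor
      · rintro ⟨-, i, hi, rfl⟩
        exact ⟨i, Finset.mem_range.mpr hi, rfl⟩
      · rintro ⟨i, hi, rfl⟩
        exact ⟨Finset.mem_univ _, i, Finset.mem_range.mp hi, rfl⟩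
    rw [this, Finset.sum_image]
    intro i hi j hj hij
    simp only [Finset.coe_range, Set.mem_Iio] at hi hj
    have h := congrArg ZMod.val (add_left_cancel hij)
    rwa [ZMod.val_natCast_of_lt (by omega), ZMod.val_natCast_of_lt (by omega)] at h
  have hterm : ∀ (a : ZMod K) (b : ZMod L),
      stripe K L (cols k n) (a, b) *
        (stripe K L (cols k n) (a + 1, b) + stripe K L (cols k n) (a, b + 1))
      = if a ∈ cols k n then (if a + 1 ∈ cols k n then 1 else 0) + 1 else 0 := by
    intro a b
    by_cases h : a ∈ cols k n <;> simp [stripe, h]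
  rw [bonds, Fintype.sum_prod_type,
    Finset.sum_congr rfl fun a _ => Finset.sum_congr rfl fun b _ => hterm a b,
    Finset.sum_comm, Finset.sum_const, Finset.card_univ, ZMod.card, hsum, nsmul_eq_mul]
  congr 1
  have hi : ∀ i ∈ Finset.range n,
      ((if k + (i : ZMod K) + 1 ∈ cols k n then (1 : ℤ) else 0) + 1)
        = if i + 1 < n then 2 else 1 := by
    intro i hi
    have hi := Finset.mem_range.mp hi
    have := add_mem_cols (k := k) hn.le (show i + 1 < K by omega)
    rw [add_assoc, ← Nat.cast_add_one]
    simp only [this]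
    split_ifs <;> rfl
  rw [Finset.sum_congr rfl hi]
  obtain ⟨m, rfl⟩ : ∃ m, n = m + 1 := ⟨n - 1, by omega⟩
  rw [Finset.sum_range_succ, Finset.sum_congr rfl (g := fun _ => 2)]
  · simp
    ring
  · intro i hi
    have := Finset.mem_range.mp hi
    simp [this]

/-! ### From configurations to occupation numbers. -/

theorem occ_groundState {n : ℕ} (hn : n ≤ K) (k : ZMod K) :
    occ (groundState K L n hn k) = stripe K L (cols k n) := by
  funext x
  by_cases h : ∃ i < n, x.1 = k + (i : ZMod K)
  · have h' : x.1 ∈ cols k n := h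
    simp [occ, groundState, stripe, h, h']
  · have h' : x.1 ∉ cols k n := h
    simp only [occ, groundState, stripe, if_neg h, if_neg h']
    rfl

theorem occ_injective {N : ℕ} : Function.Injective (occ : Config K L N → Site K L → ℤ) := by
  intro η ξ h
  apply Subtype.ext
  funext x
  have := congrFun h x
  simp only [occ, Nat.cast_inj] at this
  exact Fin.ext this

theorem occ_eq_zero_or_one {N : ℕ} (η : Config K L N) (x : Site K L) :
    occ η x = 0 ∨ occ η x = 1 := by
  simp only [occ]
  omega

/-- An exchange that changes the configuration involves two different values, so one end of the bond
holds a particle and the other is empty. -/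
theorem jump_of_adj {N : ℕ} {η ξ : Config K L N} (h : (kawasakiGraph K L N).Adj η ξ) :
    Jump (occ η) (occ ξ) := by
  obtain ⟨hne, x, y, hxy, hsw⟩ := h
  have main : ∀ x y : Site K L, (lattice K L).Adj x y → ξ.1 = η.1 ∘ Equiv.swap x y →
      occ η x = 1 → occ η y = 0 → Jump (occ η) (occ ξ) := by
    intro x y hxy hsw hx hy
    refine ⟨x, y, hx, hy, ?_, ?_⟩
    · funext z
      have hz : occ ξ z = occ η (Equiv.swap x y z) := by simp [occ, hsw]
      have hxy' := hxy.ne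
      rw [hz]
      by_cases h1 : z = x
      · subst h1
        simp [hx, hy, hxy']
      · by_cases h2 : z = y
        · subst h2
          simp [hx, hy, h1]
        · simp [Equiv.swap_apply_of_ne_of_ne h1 h2, h1, h2]
    · obtain ⟨-, ⟨h1, h2 | h2⟩ | ⟨h1, h2 | h2⟩⟩ := lattice_adj.mp hxy
      · exact .inl ⟨-1, .inr rfl, Prod.ext (by rw [← h2]; ring) h1.symm⟩
      · exact .inl ⟨1, .inl rfl, Prod.ext (by rw [← h2]; ring) h1.symm⟩
      · exact .inr ⟨-1, .inr rfl, Prod.ext h1.symm (by rw [← h2]; ring)⟩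
      · exact .inr ⟨1, .inl rfl, Prod.ext h1.symm (by rw [← h2]; ring)⟩
  have hdiff : occ η x ≠ occ η y := by
    intro he
    apply hne
    apply Subtype.ext
    have he' : η.1 x = η.1 y := by
      simp only [occ, Nat.cast_inj] at he
      exact Fin.ext he
    rw [hsw]
    funext z
    rw [Function.comp_apply, Equiv.swap_apply_def]
    split_ifs with h1 h2
    · rw [h1, he']
    · rw [h2, he']
    · rfl
  rcases occ_eq_zero_or_one η x with hx | hx <;> rcases occ_eq_zero_or_one η y with hy | hy
  · exact absurd (hx.trans hy.symm) hdiff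
  · exact main y x hxy.symm (by rw [Equiv.swap_comm]; exact hsw) hy hx
  · exact main x y hxy hsw hx hy
  · exact absurd (hx.trans hy.symm) hdiff

theorem exists_adj_of_move {N : ℕ} (η : Config K L N) {p q : Site K L}
    (hpq : (lattice K L).Adj p q) (hp : occ η p = 1) (hq : occ η q = 0) :
    ∃ ξ, (kawasakiGraph K L N).Adj η ξ ∧ occ ξ = occ η - Pi.single p 1 + Pi.single q 1 := by
  have hsum : ∑ x, ((η.1 ∘ Equiv.swap p q) x : ℕ) = N := by
    exact (Equiv.sum_comp (Equiv.swap p q) fun x => (η.1 x : ℕ)).trans η.2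
  have hne := hpq.ne
  have hocc : occ (⟨η.1 ∘ Equiv.swap p q, hsum⟩ : Config K L N)
      = occ η - Pi.single p 1 + Pi.single q 1 := by
    funext z
    change occ η (Equiv.swap p q z) = _
    by_cases h1 : z = p
    · subst h1
      simp [hp, hq, hne]
    · by_cases h2 : z = q
      · subst h2
        simp [hp, hq, h1]
      · simp [Equiv.swap_apply_of_ne_of_ne h1 h2, h1, h2]
  refine ⟨_, ⟨?_, p, q, hpq, rfl⟩, hocc⟩
  intro he
  have := congrArg (fun ζ => occ ζ p) he
  simp [hocc, hp, hne] at this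

/-! ### The lower bound for paths. -/

/-- Every path between two different ground states reaches the height `H₀ + 4`. -/
theorem le_pathHeight_groundState {n : ℕ} (h3 : 3 ≤ n) (hn : 2 * n < K) (hL : 3 ≤ L)
    {k k' : ZMod K} (hk : k ≠ k')
    (ω : (kawasakiGraph K L (L * n)).Walk (groundState K L n (by omega) k)
      (groundState K L n (by omega) k')) :
    (-2 * (L : ℤ) * (n : ℤ) + (L : ℤ)) + 4 ≤ pathHeight energy ω := by
  have hK : 3 ≤ K := by omega
  have hC : ThickStripe (cols k n) := thickStripe_cols h3 (by omega)
  have hB := bonds_stripe_cols (L := L) (k := k) (show 0 < n by omega) (show n < K by omega)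
  by_contra! hlt
  -- Energies are integers: lying strictly below `H₀ + 4` means losing at most three bonds.
  have hsupp : ∀ ζ ∈ ω.support, bonds (stripe K L (cols k n)) - 3 ≤ bonds (occ ζ) := by
    intro ζ hζ
    obtain ⟨i, rfl, hi⟩ := SimpleGraph.Walk.mem_support_iff_exists_getVert.mp hζ
    have h1 := Finset.le_sup' (fun i => energy (ω.getVert i))
      (show i ∈ Finset.range (ω.length + 1) by simp; omega)
    have h2 : energy (ω.getVert i) ≤ pathHeight energy ω := h1
    rw [energy_eq hK hL] at h2
    rw [hB]
    linarith
  have hinv : ∀ {η ξ : Config K L (L * n)} (ω : (kawasakiGraph K L (L * n)).Walk η ξ),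
      (∀ ζ ∈ ω.support, bonds (stripe K L (cols k n)) - 3 ≤ bonds (occ ζ)) →
      Trapped (cols k n) (occ η) → Trapped (cols k n) (occ ξ) := by
    intro η ξ ω
    induction ω with
    | nil => exact fun _ h => h
    | cons hadj ω ih =>
      intro hs ht
      simp only [SimpleGraph.Walk.support_cons, List.mem_cons, forall_eq_or_imp] at hs
      exact ih hs.2 (trapped_of_jump hC hK hL ht (jump_of_adj hadj)
        (hs.2 _ ω.start_mem_support))
  have hend := hinv ω hsupp (.inl (occ_groundState _ k))
  rw [occ_groundState] at hend
  -- If `k'` lies in the block of `k`, its last column sticks out, without wrapping around because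
  -- `2 * n < K`; otherwise its first column does.
  obtain ⟨a, ha, ha'⟩ : ∃ a, a ∈ cols k' n ∧ a ∉ cols k n := by
    obtain ⟨i, hi, rfl⟩ := exists_eq_add k k'
    by_cases hin : i < n
    · have hi0 : i ≠ 0 := by
        rintro rfl
        simp at hk
      refine ⟨k + (i : ZMod K) + ((n - 1 : ℕ) : ZMod K), ⟨n - 1, by omega, rfl⟩, ?_⟩
      rw [add_assoc, ← Nat.cast_add, add_mem_cols (by omega) (by omega)]
      omega
    · exact ⟨k + (i : ZMod K), ⟨0, by omega, by simp⟩, by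
        rwa [add_mem_cols (by omega) hi]⟩
  exact not_trapped hL ha' (fun b => stripe_of_mem ha b) hend

/-! ### The upper bound: an explicit path. -/

/-- There is a path from `η` to `ξ` of height at most `E`. -/
def ReachBelow {N : ℕ} (E : ℤ) (η ξ : Config K L N) : Prop :=
  ∃ ω : (kawasakiGraph K L N).Walk η ξ, ∀ ζ ∈ ω.support, energy ζ ≤ E

theorem ReachBelow.trans {N : ℕ} {E : ℤ} {η ξ ζ : Config K L N} (h : ReachBelow E η ξ)
    (h' : ReachBelow E ξ ζ) : ReachBelow E η ζ := by
  obtain ⟨ω, hω⟩ := h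
  obtain ⟨ω', hω'⟩ := h'
  refine ⟨ω.append ω', fun x hx => ?_⟩
  rcases SimpleGraph.Walk.mem_support_append_iff _ _ |>.mp hx with h | h
  · exact hω x h
  · exact hω' x h

theorem ReachBelow.single {N : ℕ} {E : ℤ} {η ξ : Config K L N}
    (h : (kawasakiGraph K L N).Adj η ξ) (hη : energy η ≤ E) (hξ : energy ξ ≤ E) :
    ReachBelow E η ξ := by
  refine ⟨h.toWalk, fun x hx => ?_⟩
  simp only [SimpleGraph.Walk.support_cons, SimpleGraph.Walk.support_nil, List.mem_cons,
    List.not_mem_nil, or_false] at hx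
  rcases hx with rfl | rfl <;> assumption

/-- The core columns `D`, the column `k` in the rows above `r`, and the column `e` in the rows
below `r`. -/
noncomputable def partialStripe (K L : ℕ) (D : Set (ZMod K)) (k e : ZMod K) (r : ℕ) :
    Site K L → ℤ :=
  fun x => stripe K L D x + (if x.1 = k ∧ r < x.2.val then 1 else 0)
    + (if x.1 = e ∧ x.2.val < r then 1 else 0)

section
variable {D : Set (ZMod K)} {k e : ZMod K} (hk : k ∉ D) (he : e ∉ D) (hke : k ≠ e)

omit [NeZero K] [NeZero L] in
theorem partialStripe_of_mem (hk : k ∉ D) (he : e ∉ D) {a : ZMod K} (ha : a ∈ D) (b : ZMod L)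
    (r : ℕ) : partialStripe K L D k e r (a, b) = 1 := by
  have h1 : a ≠ k := by rintro rfl; exact hk ha
  have h2 : a ≠ e := by rintro rfl; exact he ha
  simp [partialStripe, stripe, ha, h1, h2]

omit [NeZero K] [NeZero L] in
theorem partialStripe_left (hk : k ∉ D) (hke : k ≠ e) (b : ZMod L) (r : ℕ) :
    partialStripe K L D k e r (k, b) = if r < b.val then 1 else 0 := by
  simp [partialStripe, stripe, hk, hke]

omit [NeZero K] [NeZero L] in
theorem partialStripe_right (he : e ∉ D) (hke : k ≠ e) (b : ZMod L) (r : ℕ) :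
    partialStripe K L D k e r (e, b) = if b.val < r then 1 else 0 := by
  simp [partialStripe, stripe, he, hke.symm]

omit [NeZero K] [NeZero L] in
theorem partialStripe_of_notMem {a : ZMod K} (ha : a ∉ D) (h1 : a ≠ k) (h2 : a ≠ e)
    (b : ZMod L) (r : ℕ) : partialStripe K L D k e r (a, b) = 0 := by
  simp [partialStripe, stripe, ha, h1, h2]

include hk he hke

omit [NeZero K] [NeZero L] in
theorem partialStripe_mem_Icc (x : Site K L) (r : ℕ) :
    0 ≤ partialStripe K L D k e r x ∧ partialStripe K L D k e r x ≤ 1 := by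
  obtain ⟨a, b⟩ := x
  by_cases ha : a ∈ D
  · simp [partialStripe_of_mem hk he ha]
  by_cases h1 : a = k
  · subst h1
    rw [partialStripe_left hk hke]
    split_ifs <;> simp
  by_cases h2 : a = e
  · subst h2
    rw [partialStripe_right he hke]
    split_ifs <;> simp
  · simp [partialStripe_of_notMem ha h1 h2]

-- This identity joins consecutive rows: the traveller that has arrived at `(e, r)` becomes part of
-- the background, and the particle at `(k, r + 1)` becomes the next traveller.
omit [NeZero K] in
theorem partialStripe_succ {r : ℕ} (hr : r + 1 < L) :
    partialStripe K L D k e (r + 1) = partialStripe K L D k e r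
      - Pi.single (k, ((r + 1 : ℕ) : ZMod L)) 1 + Pi.single (e, (r : ZMod L)) 1 := by
  funext ⟨a, b⟩
  have hb : ∀ i < L, (b = (i : ZMod L) ↔ b.val = i) := by
    intro i hi
    constructor
    · rintro rfl
      exact ZMod.val_natCast_of_lt hi
    · rintro rfl
      simp
  simp only [Pi.add_apply, Pi.sub_apply, Pi.single_apply, Prod.mk.injEq, hb _ hr,
    hb r (by omega)]
  by_cases ha : a ∈ D
  · have h1 : a ≠ k := by rintro rfl; exact hk ha
    have h2 : a ≠ e := by rintro rfl; exact he ha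
    simp [partialStripe_of_mem hk he ha, h1, h2]
  by_cases h1 : a = k
  · subst h1
    simp only [partialStripe_left hk hke, hke, false_and, true_and, if_false]
    split_ifs <;> omega
  by_cases h2 : a = e
  · subst h2
    simp only [partialStripe_right he hke, hke.symm, false_and, true_and, if_false]
    split_ifs <;> omega
  · simp [partialStripe_of_notMem ha h1 h2, h1, h2]

/-- Each transfer removes a corner particle with at most two bonds. The new particle gains at least
one bond in row 0 and, resting on its predecessor, at least two in later rows, so only the first
transfer can cost a bond. -/
theorem le_bonds_partialStripe (hK : 3 ≤ K) (hL : 3 ≤ L) (hk1 : k + 1 ∈ D) (hk2 : k - 1 ∉ D)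
    (hke1 : k - 1 ≠ e) (he1 : e - 1 ∈ D) {r : ℕ} (hr : r < L) :
    bonds (partialStripe K L D k e 0) - (if r = 0 then 0 else 1)
      ≤ bonds (partialStripe K L D k e r) := by
  have k0 := one_ne_zero_zmod hK
  induction r with
  | zero => simp
  | succ r ih =>
    have ih := ih (by omega)
    have hval : ((r + 1 : ℕ) : ZMod L).val = r + 1 := ZMod.val_natCast_of_lt hr
    rw [partialStripe_succ hk he hke hr, bonds_move hK hL]
    have hfrom : nbr (partialStripe K L D k e r) (k, ((r + 1 : ℕ) : ZMod L)) ≤ 2 := by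
      have h1 := (partialStripe_mem_Icc hk he hke (k + 1, ((r + 1 : ℕ) : ZMod L)) r).2
      have h2 := (partialStripe_mem_Icc hk he hke (k, ((r + 1 : ℕ) : ZMod L) + 1) r).2
      have h3 : partialStripe K L D k e r (k - 1, ((r + 1 : ℕ) : ZMod L)) = 0 :=
        partialStripe_of_notMem hk2 (by simpa [sub_eq_self] using k0) hke1 _ _
      have h4 : partialStripe K L D k e r (k, ((r + 1 : ℕ) : ZMod L) - 1) = 0 := by
        rw [partialStripe_left hk hke, Nat.cast_add_one, add_sub_cancel_right,
          ZMod.val_natCast_of_lt (by omega)]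
        simp
      simp only [nbr]
      omega
    have hnn : ∀ x : Site K L, 0 ≤ (partialStripe K L D k e r
        - Pi.single (k, ((r + 1 : ℕ) : ZMod L)) 1 : Site K L → ℤ) x := by
      intro x
      have h1 := (partialStripe_mem_Icc hk he hke x r).1
      by_cases hx : x = (k, ((r + 1 : ℕ) : ZMod L))
      · subst hx
        rw [Pi.sub_apply, partialStripe_left hk hke, hval, Pi.single_eq_same]
        simp
      · rwa [Pi.sub_apply, Pi.single_eq_of_ne hx, sub_zero]
    have hto : (if r = 0 then 1 else 2) ≤ nbr (partialStripe K L D k e r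
        - Pi.single (k, ((r + 1 : ℕ) : ZMod L)) 1) (e, (r : ZMod L)) := by
      have h1 := hnn (e + 1, (r : ZMod L))
      have h2 := hnn (e, (r : ZMod L) + 1)
      have h3 : (partialStripe K L D k e r
          - Pi.single (k, ((r + 1 : ℕ) : ZMod L)) 1 : Site K L → ℤ) (e - 1, (r : ZMod L)) = 1 := by
        have hne : e - 1 ≠ k := by rintro rfl; exact hk he1
        simp [partialStripe_of_mem hk he he1, hne]
      have h4 := hnn (e, (r : ZMod L) - 1)
      simp only [nbr]
      split_ifs with h0
      · omega
      · have h5 : (partialStripe K L D k e r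
            - Pi.single (k, ((r + 1 : ℕ) : ZMod L)) 1 : Site K L → ℤ) (e, (r : ZMod L) - 1)
            = 1 := by
          obtain ⟨j, rfl⟩ : ∃ j, r = j + 1 := ⟨r - 1, by omega⟩
          have hlt : ((j + 1 : ℕ) : ZMod L) - 1 = (j : ZMod L) := by push_cast; ring
          rw [hlt]
          simp [partialStripe_right he hke, hke.symm,
            ZMod.val_natCast_of_lt (show j < L by omega)]
        omega
    rw [if_neg (Nat.succ_ne_zero r)]
    split_ifs at ih hto <;> omega
end

omit [NeZero K] [NeZero L] in
theorem partialStripe_zero_add {D : Set (ZMod K)} {k e : ZMod K} (hk : k ∉ D) :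
    partialStripe K L D k e 0 + Pi.single (k, 0) 1 = stripe K L (insert k D) := by
  funext ⟨a, b⟩
  have hb : 0 < b.val ↔ b ≠ 0 := by rw [Nat.pos_iff_ne_zero, Ne, ZMod.val_eq_zero]
  simp only [Pi.add_apply, Pi.single_apply, partialStripe, stripe, Prod.mk.injEq, hb,
    Set.mem_insert_iff, not_lt_zero, and_false, if_false]
  by_cases h1 : a = k
  · subst h1
    by_cases h2 : b = 0 <;> simp [h2, hk]
  · by_cases h2 : a ∈ D <;> simp [h1, h2]

omit [NeZero K] in
theorem partialStripe_last_add {D : Set (ZMod K)} {k e : ZMod K} (he : e ∉ D) :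
    partialStripe K L D k e (L - 1) + Pi.single (e, ((L - 1 : ℕ) : ZMod L)) 1
      = stripe K L (insert e D) := by
  funext ⟨a, b⟩
  have hL := NeZero.pos L
  have hlt := ZMod.val_lt b
  have hb : b = ((L - 1 : ℕ) : ZMod L) ↔ ¬ b.val < L - 1 := by
    constructor
    · rintro rfl
      rw [ZMod.val_natCast_of_lt (by omega)]
      simp
    · intro h
      have : b.val = L - 1 := by omega
      rw [← this]
      simp
  have hb' : ¬ L - 1 < b.val := by omega
  simp only [Pi.add_apply, Pi.single_apply, partialStripe, stripe, Prod.mk.injEq, hb, hb',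
    Set.mem_insert_iff, and_false, if_false]
  by_cases h1 : a = e
  · subst h1
    by_cases h2 : b.val < L - 1 <;> simp [h2, he]
  · by_cases h2 : a ∈ D <;> simp [h1, h2]

theorem exists_reachBelow_groundState_succ {n : ℕ} (h3 : 3 ≤ n) (hn : 2 * n < K) (hL : 3 ≤ L)
    (k : ZMod K) :
    ReachBelow ((-2 * (L : ℤ) * (n : ℤ) + (L : ℤ)) + 4)
      (groundState K L n (by omega) k) (groundState K L n (by omega) (k + 1)) := by
  have hK : 3 ≤ K := by omega
  have hKz : (K : ZMod K) = 0 := ZMod.natCast_self K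
  obtain ⟨m, rfl⟩ : ∃ m, n = m + 1 := ⟨n - 1, by omega⟩
  set D := cols (k + 1) m with hD
  set e : ZMod K := k + 1 + (m : ZMod K) with hedef
  -- the columns `k - j`, for `j ≤ K - (m + 1)`, avoid the core
  have hmem : ∀ i < K, (k + 1 + (i : ZMod K) ∈ D ↔ i < m) := fun i hi =>
    add_mem_cols (by omega) hi
  have hsub : ∀ j ≤ K - (m + 1), k - (j : ZMod K) ∉ D := by
    intro j hj
    have : k - (j : ZMod K) = k + 1 + ((K - 1 - j : ℕ) : ZMod K) := by
      push_cast [show 1 ≤ K by omega, show j ≤ K - 1 by omega]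
      rw [hKz]
      ring
    rw [this, hmem _ (by omega)]
    omega
  -- Going left through all `K - (m + 1)` columns outside the original stripe ends, by periodicity,
  -- at its right neighbour `e`.
  have hlast : k - ((K - (m + 1) : ℕ) : ZMod K) = e := by
    push_cast [show m + 1 ≤ K by omega]
    rw [hKz, hedef]
    ring
  have hne : ∀ i : ℕ, 0 < i → i < K → k ≠ k + (i : ZMod K) := by
    intro i h0 hi h
    exact natCast_ne_zero h0 hi (by linear_combination -h)
  have hkD : k ∉ D := by simpa using hsub 0 (by omega)
  have heD : e ∉ D := by rw [hedef, hmem m (by omega)]; omega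
  have hke : k ≠ e := by
    have := hne (m + 1) (by omega) (by omega)
    rw [hedef]
    push_cast at this
    convert this using 1
    ring
  have hk1 : k + 1 ∈ D := by simpa using (hmem 0 (by omega)).2 (by omega)
  have hk2 : k - 1 ∉ D := by simpa using hsub 1 (by omega)
  have hke1 : k - 1 ≠ e := by
    intro h
    have := hne (m + 2) (by omega) (by omega)
    apply this
    push_cast
    linear_combination h + hedef
  have he1 : e - 1 ∈ D := by
    have := (hmem (m - 1) (by omega)).2 (by omega)
    convert this using 1
    rw [hedef]
    push_cast [show 1 ≤ m by omega]
    ring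
  have hC : cols k (m + 1) = insert k D := cols_succ k m
  have hC' : cols (k + 1) (m + 1) = insert e D := cols_succ' (k + 1) m
  have hB := bonds_stripe_cols (L := L) (k := k) (show 0 < m + 1 by omega)
    (show m + 1 < K by omega)
  have hB0 : bonds (partialStripe K L D k e 0)
      = bonds (stripe K L (cols k (m + 1))) - 3 := by
    have h0 : ∀ b : ZMod L, (0 < b.val) ↔ b ≠ 0 := fun b => by
      rw [Nat.pos_iff_ne_zero, Ne, ZMod.val_eq_zero]
    have h := bonds_add_single hK hL (partialStripe K L D k e 0) (k, 0)
    rw [partialStripe_zero_add hkD, ← hC] at h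
    have hn3 : nbr (partialStripe K L D k e 0) (k, (0 : ZMod L)) = 3 := by
      have l1 := one_ne_zero_zmod hL
      have k1 := one_ne_zero_zmod hK
      simp only [nbr, partialStripe_of_mem hkD heD hk1,
        partialStripe_of_notMem hk2 (show k - 1 ≠ k by simpa [sub_eq_self] using k1) hke1,
        partialStripe_left hkD hke, h0]
      simp [l1]
    omega
  -- The background has at least `B - 4` bonds, and the traveller adds a nonnegative number wherever
  -- it stands.
  have hbd : ∀ r < L, ∀ a : ZMod K, a ∉ D → ∀ η : Config K L (L * (m + 1)),
      occ η = partialStripe K L D k e r + Pi.single (a, (r : ZMod L)) 1 →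
      energy η ≤ (-2 * (L : ℤ) * ((m + 1 : ℕ) : ℤ) + (L : ℤ)) + 4 := by
    intro r hr a ha η hη
    have h1 := le_bonds_partialStripe hkD heD hke hK hL hk1 hk2 hke1 he1 hr
    have h2 : 0 ≤ nbr (partialStripe K L D k e r) (a, (r : ZMod L)) := by
      simp only [nbr]
      have h := fun x => (partialStripe_mem_Icc (L := L) hkD heD hke x r).1
      have := h (a + 1, r)
      have := h (a - 1, r)
      have := h (a, r + 1)
      have := h (a, r - 1)
      omega
    rw [energy_eq hK hL, hη, bonds_add_single hK hL]
    rw [hB] at hB0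
    split_ifs at h1 <;> linarith
  have hrow : ∀ r < L, (∃ η : Config K L (L * (m + 1)),
      occ η = partialStripe K L D k e r + Pi.single (k, (r : ZMod L)) 1 ∧
      ReachBelow ((-2 * (L : ℤ) * ((m + 1 : ℕ) : ℤ) + (L : ℤ)) + 4)
        (groundState K L (m + 1) (by omega) k) η) →
      ∀ j ≤ K - (m + 1), ∃ η : Config K L (L * (m + 1)),
      occ η = partialStripe K L D k e r + Pi.single (k - (j : ZMod K), (r : ZMod L)) 1 ∧
      ReachBelow ((-2 * (L : ℤ) * ((m + 1 : ℕ) : ℤ) + (L : ℤ)) + 4)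
        (groundState K L (m + 1) (by omega) k) η := by
    intro r hr h0 j
    induction j with
    | zero => intro _; simpa using h0
    | succ j ih =>
      intro hj
      obtain ⟨η, hη, hreach⟩ := ih (by omega)
      have hzero : ∀ i ≤ K - (m + 1),
          partialStripe K L D k e r (k - (i : ZMod K), (r : ZMod L)) = 0 := by
        intro i hi
        have hv := ZMod.val_natCast_of_lt hr
        by_cases h1 : k - (i : ZMod K) = k
        · rw [h1, partialStripe_left hkD hke, hv]; simp
        by_cases h2 : k - (i : ZMod K) = e
        · rw [h2, partialStripe_right heD hke, hv]; simp
        · exact partialStripe_of_notMem (hsub i hi) h1 h2 _ _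
      have k1 := one_ne_zero_zmod hK
      have hcast : k - ((j + 1 : ℕ) : ZMod K) = k - (j : ZMod K) - 1 := by push_cast; ring
      have hpq : (lattice K L).Adj (k - (j : ZMod K), (r : ZMod L))
          (k - ((j + 1 : ℕ) : ZMod K), (r : ZMod L)) := by
        rw [lattice_adj, hcast]
        refine ⟨fun h => k1 ?_, .inl ⟨rfl, .inl (by ring)⟩⟩
        linear_combination congrArg Prod.fst h
      obtain ⟨ξ, hadj, hξ⟩ := exists_adj_of_move η hpq
        (by rw [hη]; simp [hzero j (by omega)])
        (by
          rw [hη, Pi.add_apply, hzero (j + 1) hj, hcast]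
          simp [k1, sub_eq_self])
      rw [hη, add_sub_cancel_right] at hξ
      exact ⟨ξ, hξ, hreach.trans (.single hadj (hbd r hr _ (hsub j (by omega)) η hη)
        (hbd r hr _ (hsub (j + 1) hj) ξ hξ))⟩
  have hmain : ∀ r < L, ∀ j ≤ K - (m + 1), ∃ η : Config K L (L * (m + 1)),
      occ η = partialStripe K L D k e r + Pi.single (k - (j : ZMod K), (r : ZMod L)) 1 ∧
      ReachBelow ((-2 * (L : ℤ) * ((m + 1 : ℕ) : ℤ) + (L : ℤ)) + 4)
        (groundState K L (m + 1) (by omega) k) η := by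
    intro r
    induction r with
    | zero =>
      intro hr
      refine hrow 0 hr ⟨groundState K L (m + 1) (by omega) k, ?_, ?_⟩
      · rw [occ_groundState, hC, Nat.cast_zero, partialStripe_zero_add hkD]
      · refine ⟨.nil, fun ζ hζ => ?_⟩
        simp only [SimpleGraph.Walk.support_nil, List.mem_singleton] at hζ
        rw [hζ, energy_eq hK hL, occ_groundState, hB]
        linarith
    | succ r ih =>
      intro hr
      obtain ⟨η, hη, hreach⟩ := ih (by omega) (K - (m + 1)) le_rfl
      refine hrow (r + 1) hr ⟨η, ?_, hreach⟩
      -- No jump happens between rows: the end of row `r` and the start of row `r + 1` are the same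
      -- configuration.
      rw [hη, hlast, partialStripe_succ hkD heD hke hr]
      abel
  obtain ⟨η, hη, hreach⟩ := hmain (L - 1) (by omega) (K - (m + 1)) le_rfl
  rw [hlast, partialStripe_last_add heD, ← hC'] at hη
  have : η = groundState K L (m + 1) (by omega) (k + 1) := by
    apply occ_injective
    rw [hη, occ_groundState]
  rwa [this] at hreach

theorem exists_reachBelow_groundState_add {n : ℕ} (h3 : 3 ≤ n) (hn : 2 * n < K) (hL : 3 ≤ L)
    (k : ZMod K) (i : ℕ) :
    ReachBelow ((-2 * (L : ℤ) * (n : ℤ) + (L : ℤ)) + 4)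
      (groundState K L n (by omega) k) (groundState K L n (by omega) (k + (i : ZMod K))) := by
  induction i with
  | zero =>
    rw [Nat.cast_zero, add_zero]
    refine ⟨.nil, fun ζ hζ => ?_⟩
    simp only [SimpleGraph.Walk.support_nil, List.mem_singleton] at hζ
    rw [hζ, energy_eq (by omega) hL, occ_groundState, bonds_stripe_cols (by omega) (by omega)]
    linarith
  | succ i ih =>
    have h := exists_reachBelow_groundState_succ h3 hn hL (k + (i : ZMod K))
    rw [add_assoc k, ← Nat.cast_add_one] at h
    exact ih.trans h

end Kawasaki

theorem theorem3p2 (K L N₀ : ℕ) [NeZero K] [NeZero L]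
    (hL : 3 ≤ L) (hKL : L < K) (hN₀ : 3 ≤ N₀) (hlow : L < 4 * N₀) (hup : 2 * N₀ < K)
    (k k' : ZMod K) (hkk' : k ≠ k') :
    (Kawasaki.kawasakiGraph K L (L * N₀)).Reachable
        (Kawasaki.groundState K L N₀ (by omega) k) (Kawasaki.groundState K L N₀ (by omega) k') ∧
      Kawasaki.commHeight (Kawasaki.kawasakiGraph K L (L * N₀)) Kawasaki.energy
          (Kawasaki.groundState K L N₀ (by omega) k) (Kawasaki.groundState K L N₀ (by omega) k')
        = (-2 * (L : ℤ) * (N₀ : ℤ) + (L : ℤ)) + 4 := by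
  have hreach := Kawasaki.exists_reachBelow_groundState_add hN₀ hup hL k (k' - k).val
  rw [ZMod.natCast_zmod_val, add_sub_cancel] at hreach
  obtain ⟨ω, hω⟩ := hreach
  have hR : (Kawasaki.kawasakiGraph K L (L * N₀)).Reachable
      (Kawasaki.groundState K L N₀ (by omega) k)
      (Kawasaki.groundState K L N₀ (by omega) k') := ⟨ω⟩
  refine ⟨hR, ?_⟩
  obtain ⟨⟨ω', hω'⟩, hmin⟩ := Kawasaki.isLeast_commHeight (H := Kawasaki.energy) hR
  apply le_antisymm
  · refine (hmin ⟨ω, rfl⟩).trans (Finset.sup'_le _ _ fun i _ => hω _ ?_)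
    exact ω.getVert_mem_support i
  · rw [← hω']
    exact Kawasaki.le_pathHeight_groundState hN₀ hup hL hkk' ω'
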